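/- Online Slot Allocation (OSA). An instance consists of $n$ slots with known costs $0\le c(1)\le\dots\le c(n)$ and a hidden probability distribution $p$ on $n$ items, with $p_i>0$ for every $i$. Requests are drawn i.i.d. from $p$. Whenever an item $i$ is requested for the first time, the algorithm must irrevocably place it in a vacant slot $j_i$; play stops once all items have been requested. A (randomized) online algorithm draws $j_i$ from a distribution on the vacant slots which is a function of $c$, the requests so far, the current assignment and the item $i$, but not of $p$. Its cost on $(p,c)$ is the expectation of $\sum_{i=1}^n p_i\,c(j_i)$ over the requests and its own random choices, and $\mathrm{OPT}(p,c)=\min_{\sigma}\sum_{i=1}^n p_i\,c(\sigma(i))$ over all bijections $\sigma$ from items to slots. The competitive ratio of an algorithm for a set $X$ of instances is the supremum over $(p,c)\in X$ of its cost divided by $\mathrm{OPT}(p,c)$ (with $0/0=0$), and the optimal competitive ratio for $X$ is the infimum of this over all online algorithms. Theorem. (i) For all integers $K\ge 0$ and $n\ge K+1$, the optimal competitive ratio for the set of instances with $n$ slots, costs $c\in\{0,1\}^n$, and exactly $K$ non-maximal cost coefficients, $|\{i : c(i)<\max_j c(j)\}|=K$, is at least $1+H_K$, where $H_K=\sum_{k=1}^K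 1/k$. (ii) For every $n\ge 2$, the optimal competitive ratio for the set of instances with $n$ slots and costs $c\in\{0,1\}^n$ that are concave, i.e. $c(i+2)-c(i+1)\le c(i+1)-c(i)$ for $1\le i\le n-2$, is at least $2$. In particular, the same lower bounds hold for larger sets of instances, such as those with at most $K$ non-maximal coefficients, or with an arbitrary number $n$ of slots. -/

import Mathlib

open scoped NNReal ENNReal

namespace OSA

/-- An instance of Online Slot Allocation with `n` slots and `n` items: a cost vector
`c 0 ≤ c 1 ≤ ⋯` (known to the algorithm) and a probability distribution `p` on the items
(hidden), every item having positive probability, so that play ends almost surely. -/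
structure Instance (n : ℕ) where
  /-- The cost of each slot. -/
  c : Fin n → ℝ≥0
  /-- Slots are listed in order of non-decreasing cost. -/
  mono : Monotone c
  /-- The request distribution. -/
  p : PMF (Fin n)
  /-- Every item is requested with positive probability. -/
  pos : ∀ i, p i ≠ 0

/-- A position of the game: the sequence of requests so far (with repetitions, in order of
arrival) and the slots given to items (`none` for an item without a slot). -/
structure State (n : ℕ) where
  /-- The requests so far. -/
  requests : List (Fin n)
  /-- The partial assignment of slots to items. -/
  slot : Fin n → Option (Fin n)

/-- A position is legal if exactly the requested items have a slot, and no slot is used twice. -/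
structure State.Legal {n : ℕ} (s : State n) : Prop where
  assigned_iff : ∀ i, s.slot i ≠ none ↔ i ∈ s.requests
  injective : ∀ i i' j, s.slot i = some j → s.slot i' = some j → i = i'

/-- A (randomized) online algorithm: when an item `i` without a slot is requested, the slot for
`i` is drawn from a distribution `place c s i` on the vacant slots. This distribution is a function
of the slot costs `c`, the requests so far, the current assignment, and the item `i`;
it does not depend on the request distribution. -/
structure OnlineAlgorithm (n : ℕ) where
  /-- The distribution of the slot chosen for the newly requested item. -/
  place : (Fin n → ℝ≥0) → State n → Fin n → PMF (Fin n)
  /-- Only vacant slots are chosen. -/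
  vacant : ∀ c (s : State n) i, s.Legal → i ∉ s.requests →
    ∀ j ∈ (place c s i).support, ∀ i', s.slot i' ≠ some j

/-- One round: a request `i` is drawn from `p` (independently of the past); if `i` has not been
requested before, the algorithm draws a slot for it. -/
noncomputable def step {n : ℕ} (A : OnlineAlgorithm n) (I : Instance n) (s : State n) :
    PMF (State n) :=
  I.p.bind fun i =>
    if i ∈ s.requests then PMF.pure ⟨s.requests ++ [i], s.slot⟩
    else (A.place I.c s i).map fun j => ⟨s.requests ++ [i], Function.update s.slot i (some j)⟩

/-- The law of the position after `t` requests. (Requests made after all items have a slot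
leave the assignment unchanged, so there is no need to stop the play explicitly.) -/
noncomputable def law {n : ℕ} (A : OnlineAlgorithm n) (I : Instance n) : ℕ → PMF (State n)
  | 0 => PMF.pure ⟨[], fun _ => none⟩
  | t + 1 => (law A I t).bind (step A I)

/-- The cost paid so far: the sum of `p i * c j` over the items `i` that have a slot `j`. -/
noncomputable def paid {n : ℕ} (I : Instance n) (s : State n) : ℝ≥0∞ :=
  ∑ i, (s.slot i).elim 0 fun j => I.p i * (I.c j : ℝ≥0∞)

/-- The expected assignment cost of an algorithm on an instance. The cost paid in the first `t`
rounds is non-negative, increases with `t`, and is constant once all items have been requested,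
so the expected cost of the complete assignment is the supremum over `t` of the expected cost paid
in the first `t` rounds. -/
noncomputable def cost {n : ℕ} (A : OnlineAlgorithm n) (I : Instance n) : ℝ≥0∞ :=
  ⨆ t, ∑' s, law A I t s * paid I s

/-- The optimal offline cost: the minimum cost of a bijective assignment of items to slots. -/
noncomputable def opt {n : ℕ} (I : Instance n) : ℝ≥0∞ :=
  ⨅ σ : Equiv.Perm (Fin n), ∑ i, I.p i * (I.c (σ i) : ℝ≥0∞)

/-- The competitive ratio of an algorithm for a set of inputs. (If `opt I = 0` then all costs are
zero, and the ratio `0 / 0 = 0` does not affect the supremum.) -/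
noncomputable def competitiveRatio {n : ℕ} (A : OnlineAlgorithm n) (X : Set (Instance n)) :
    ℝ≥0∞ :=
  ⨆ I ∈ X, cost A I / opt I

/-- The optimal competitive ratio of online algorithms for a set of inputs. -/
noncomputable def optimalRatio {n : ℕ} (X : Set (Instance n)) : ℝ≥0∞ :=
  ⨅ A : OnlineAlgorithm n, competitiveRatio A X

/-- Cost vectors with entries in `{0, 1}`. -/
def IsZeroOne {n : ℕ} (c : Fin n → ℝ≥0) : Prop :=
  ∀ j, c j = 0 ∨ c j = 1

/-- The number of coefficients of a cost vector that are smaller than the maximum coefficient. -/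
noncomputable def numNonMaximal {n : ℕ} (c : Fin n → ℝ≥0) : ℕ :=
  {i | ∃ j, c i < c j}.ncard

/-- Concave cost vectors: consecutive differences are non-increasing. -/
def IsConcave {n : ℕ} (c : Fin n → ℝ≥0) : Prop :=
  ∀ (i : ℕ) (h : i + 2 < n),
    (c ⟨i + 2, h⟩ : ℝ) - c ⟨i + 1, by omega⟩ ≤ c ⟨i + 1, by omega⟩ - c ⟨i, by omega⟩

end OSA

/-!
The hard instances have `K` slots of cost `0` and `n - K` slots of cost `1`. For a set `B` of `K`
items, every item of `B` has probability `β` and every other item probability `γ`, where `γ` is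
tiny. Write `δ = (n - K) γ = 1 - K β` for the total probability of the light items, so that
`opt ≤ δ`. Once every item has a slot, either the items in the free slots are exactly those of `B`,
and the cost is `δ`, or some heavy item sits in a slot of cost `1`, and the cost is at least `β`
(`le_paid_add_guess`). So the algorithm has to guess `B`, and its expected cost is at least
`β - (β - δ) P`, where `P` is the probability that no request among the first `L` has refuted the
guess (`le_cost_add`).

To bound `P` on average over `B`, fix a word `v` of at most `L` requests with at most `K` distinct
letters. If `γ` is small compared with `β ^ L`, then under a uniformly random `B` the word `v` is
far more likely to come from some `B` containing all its letters than from any other `B`. Hence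
the best strategy, even offline, is to put all letters of `v` into free slots, which succeeds
exactly when all letters of `v` are heavy (`sum_wordWeight_mul_guess_le`). Consequently
(`sum_wordWeight_mul_avg_guess_le`) `P` is at most the probability `survival` that no light item
is requested among the first `L` requests before all `K` heavy ones have been seen.
This probability is `1 - δ b`, where `b` (`missTime`) tends, as `γ → 0` and then `L → ∞`, to the
coupon collector's time `K H_K` (`tendsto_missTime`). Dividing by `δ` gives the ratio
`1 + (β - δ) b → 1 + (1 / K) * K H_K = 1 + H_K`. For `K = 1` the cost vector `(0, 1, …, 1)` is
concave, which gives the second claim.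

The order of quantifiers matters: the horizon `L` is fixed first, and then `γ` is chosen so small
that the comparison of likelihoods holds for all words of length at most `L`.
-/

namespace OSA

/-! ### Expectations -/

/-- The expectation of a non-negative function. -/
noncomputable def expect {α : Type} (μ : PMF α) (f : α → ℝ≥0∞) : ℝ≥0∞ := ∑' a, μ a * f a

section Expect
variable {α β : Type}

lemma expect_bind (μ : PMF α) (q : α → PMF β) (f : β → ℝ≥0∞) :
    expect (μ.bind q) f = expect μ fun a => expect (q a) f := by
  simp only [expect, PMF.bind_apply, ← ENNReal.tsum_mul_right, ← ENNReal.tsum_mul_left]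
  rw [ENNReal.tsum_comm]
  simp only [mul_assoc]

lemma expect_mono {μ : PMF α} {f g : α → ℝ≥0∞} (h : ∀ a ∈ μ.support, f a ≤ g a) :
    expect μ f ≤ expect μ g := by
  refine ENNReal.tsum_le_tsum fun a => ?_
  by_cases ha : μ a = 0
  · simp [ha]
  · gcongr; exact h a ((PMF.mem_support_iff _ _).2 ha)

lemma expect_const (μ : PMF α) (c : ℝ≥0∞) : expect μ (fun _ => c) = c := by
  rw [expect, ENNReal.tsum_mul_right, μ.tsum_coe, one_mul]

lemma expect_add (μ : PMF α) (f g : α → ℝ≥0∞) :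
    expect μ (fun a => f a + g a) = expect μ f + expect μ g := by
  simp only [expect, mul_add, ENNReal.tsum_add]

lemma expect_const_mul (μ : PMF α) (c : ℝ≥0∞) (f : α → ℝ≥0∞) :
    expect μ (fun a => c * f a) = c * expect μ f := by
  simp only [expect, ← ENNReal.tsum_mul_left]
  exact tsum_congr fun a => by ring

lemma expect_finset_sum {ι : Type} (μ : PMF α) (s : Finset ι) (f : ι → α → ℝ≥0∞) :
    expect μ (fun a => ∑ i ∈ s, f i a) = ∑ i ∈ s, expect μ (f i) := by
  simp only [expect, Finset.mul_sum]
  exact Summable.tsum_finsetSum fun _ _ => ENNReal.summable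

lemma expect_fintype [Fintype α] (μ : PMF α) (f : α → ℝ≥0∞) :
    expect μ f = ∑ a, μ a * f a := tsum_fintype _

end Expect

/-! ### Averages over random words of requests -/

variable {n : ℕ}

/-- The law of the position after the request `i` has been served in position `s`. -/
noncomputable def serve (A : OnlineAlgorithm n) (c : Fin n → ℝ≥0) (i : Fin n) (s : State n) :
    PMF (State n) :=
  if i ∈ s.requests then PMF.pure ⟨s.requests ++ [i], s.slot⟩
  else (A.place c s i).map fun j => ⟨s.requests ++ [i], Function.update s.slot i (some j)⟩

/-- The law of the position after the requests of a given word, whose head is the latest request.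
It depends on the slot costs but not on the request distribution. -/
noncomputable def run (A : OnlineAlgorithm n) (c : Fin n → ℝ≥0) : List (Fin n) → PMF (State n)
  | [] => PMF.pure ⟨[], fun _ => none⟩
  | x :: v => (run A c v).bind (serve A c x)

/-- The average of `g` over the extensions of the word `v` by `m` further requests with weights `p`,
the latest request being put at the head. -/
noncomputable def avg (p : Fin n → ℝ≥0∞) (g : List (Fin n) → ℝ≥0∞) :
    ℕ → List (Fin n) → ℝ≥0∞
  | 0, v => g v
  | m + 1, v => ∑ x, p x * avg p g m (x :: v)

/-- Averaging over the last request first, whereas the definition splits off the next one. -/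
lemma avg_succ' (p : Fin n → ℝ≥0∞) (g : List (Fin n) → ℝ≥0∞) (m : ℕ) (v : List (Fin n)) :
    avg p g (m + 1) v = avg p (fun u => ∑ x, p x * g (x :: u)) m v := by
  induction m generalizing v with
  | zero => rfl
  | succ m ih => rw [avg]; simp only [ih]; rfl

/-- The requests can be drawn beforehand: the play is a random word, followed by a run on it. -/
lemma expect_law (A : OnlineAlgorithm n) (I : Instance n) (t : ℕ) (f : State n → ℝ≥0∞) :
    expect (law A I t) f = avg I.p (fun v => expect (run A I.c v) f) t [] := by
  induction t generalizing f with
  | zero => rfl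
  | succ t ih =>
    have hstep : ∀ s, step A I s = I.p.bind fun i => serve A I.c i s := fun s => rfl
    rw [law, expect_bind, ih, avg_succ']
    congr 1
    funext v
    simp only [hstep, expect_bind, expect_fintype I.p, run, expect_finset_sum, expect_const_mul]

lemma avg_mono {p : Fin n → ℝ≥0∞} {g h : List (Fin n) → ℝ≥0∞} (hgh : ∀ v, g v ≤ h v)
    (m : ℕ) (v : List (Fin n)) : avg p g m v ≤ avg p h m v := by
  induction m generalizing v with
  | zero => exact hgh v
  | succ m ih => exact Finset.sum_le_sum fun x _ => mul_le_mul_right (ih _) _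

lemma avg_const_mul (p : Fin n → ℝ≥0∞) (a : ℝ≥0∞) (g : List (Fin n) → ℝ≥0∞) (m : ℕ)
    (v : List (Fin n)) : avg p (fun u => a * g u) m v = a * avg p g m v := by
  induction m generalizing v with
  | zero => rfl
  | succ m ih =>
    simp only [avg, ih, Finset.mul_sum]
    exact Finset.sum_congr rfl fun x _ => by ring

lemma avg_const {p : Fin n → ℝ≥0∞} (hp : ∑ i, p i = 1) (a : ℝ≥0∞) (m : ℕ) (v : List (Fin n)) :
    avg p (fun _ => a) m v = a := by
  induction m generalizing v with
  | zero => rfl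
  | succ m ih => simp only [avg, ih, ← Finset.sum_mul, hp, one_mul]

lemma avg_antitone {p : Fin n → ℝ≥0∞} (hp : ∑ i, p i = 1) {g : List (Fin n) → ℝ≥0∞}
    (hg : ∀ x v, g (x :: v) ≤ g v) (v : List (Fin n)) : Antitone fun m => avg p g m v := by
  refine antitone_nat_of_succ_le fun m => ?_
  rw [avg_succ']
  refine avg_mono (fun u => ?_) m v
  calc ∑ x, p x * g (x :: u) ≤ ∑ x, p x * g u :=
        Finset.sum_le_sum fun x _ => mul_le_mul_right (hg x u) _
    _ = g u := by rw [← Finset.sum_mul, hp, one_mul]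

open Classical in
/-- An item stays unrequested for `m` rounds with probability at most `(1 - p i) ^ m`. -/
lemma avg_notMem_le {p : Fin n → ℝ≥0∞} (hp : ∑ i, p i = 1) (i : Fin n) (m : ℕ)
    (v : List (Fin n)) : avg p (fun u => if i ∈ u then 0 else 1) m v ≤ (1 - p i) ^ m := by
  have hi : ∑ x, (if x = i then 0 else p x) = 1 - p i := by
    have h1 : ∑ x, (if x = i then 0 else p x) + p i = 1 := by
      rw [← hp, ← Finset.sum_erase_add _ _ (Finset.mem_univ i),
        ← Finset.sum_erase_add _ p (Finset.mem_univ i)]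
      simp only [if_true, add_zero]
      congr 1
      exact Finset.sum_congr rfl fun x hx => if_neg (Finset.ne_of_mem_erase hx)
    have h2 : p i ≠ ⊤ := fun h => by simp [h] at h1
    exact ENNReal.eq_sub_of_add_eq h2 h1
  induction m generalizing v with
  | zero => simp only [avg, pow_zero]; split_ifs <;> simp
  | succ m ih =>
    rw [avg_succ']
    have hstep : ∀ u : List (Fin n), ∑ x, p x * (if i ∈ x :: u then 0 else 1)
        = (1 - p i) * (if i ∈ u then 0 else 1) := by
      intro u
      rw [← hi, Finset.sum_mul]
      refine Finset.sum_congr rfl fun x _ => ?_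
      by_cases hx : x = i
      · simp [hx]
      · simp [hx, Ne.symm hx, List.mem_cons]
    simp only [hstep, avg_const_mul]
    rw [pow_succ']
    exact mul_le_mul_right (ih v) _

/-! ### Legality and completeness of play -/

lemma mem_support_serve {A : OnlineAlgorithm n} {c : Fin n → ℝ≥0} {i : Fin n} {s s' : State n}
    (hs : s.Legal) (h : s' ∈ (serve A c i s).support) :
    s'.Legal ∧ s'.requests = s.requests ++ [i] ∧
      ∀ i' j, s.slot i' = some j → s'.slot i' = some j := by
  unfold serve at h
  split_ifs at h with hi
  · rw [PMF.mem_support_pure_iff] at h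
    subst h
    refine ⟨⟨fun i' => ?_, hs.injective⟩, rfl, fun _ _ => id⟩
    simp only [List.mem_append, List.mem_singleton]
    rw [hs.assigned_iff]
    constructor
    · exact Or.inl
    · rintro (h | rfl) <;> assumption
  · rw [PMF.mem_support_map_iff] at h
    obtain ⟨j, hj, rfl⟩ := h
    have hv := A.vacant c s i hs hi j hj
    have hnone : s.slot i = none := by
      by_contra h
      exact hi ((hs.assigned_iff i).1 h)
    refine ⟨⟨fun i' => ?_, fun i₁ i₂ k h₁ h₂ => ?_⟩, rfl, fun i' k h => ?_⟩
    · simp only [List.mem_append, List.mem_singleton]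
      by_cases h : i' = i
      · simp [h]
      · simp [h, ← hs.assigned_iff]
    · simp only [Function.update_apply] at h₁ h₂
      split_ifs at h₁ h₂ with e₁ e₂ e₂
      · rw [e₁, e₂]
      · exact absurd (h₂.trans h₁.symm) (hv i₂)
      · exact absurd (h₁.trans h₂.symm) (hv i₁)
      · exact hs.injective _ _ _ h₁ h₂
    · have : i' ≠ i := by rintro rfl; simp [hnone] at h
      simp [Function.update_of_ne this, h]

lemma mem_support_run {A : OnlineAlgorithm n} {c : Fin n → ℝ≥0} {v : List (Fin n)} {s : State n}
    (h : s ∈ (run A c v).support) : s.Legal ∧ s.requests = v.reverse := by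
  induction v generalizing s with
  | nil =>
    rw [run, PMF.mem_support_pure_iff] at h
    subst h
    exact ⟨⟨by simp, by simp⟩, rfl⟩
  | cons x v ih =>
    rw [run, PMF.mem_support_bind_iff] at h
    obtain ⟨s₀, h₀, h₁⟩ := h
    obtain ⟨l₀, r₀⟩ := ih h₀
    obtain ⟨l₁, r₁, -⟩ := mem_support_serve l₀ h₁
    exact ⟨l₁, by rw [r₁, r₀, List.reverse_cons]⟩

open Classical in
/-- A lower bound on the cost can be checked on complete legal positions, up to an error term `f`
whose expectation is eventually at most `b`, because play is complete with probability tending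
to `1`. -/
lemma le_cost_add {A : OnlineAlgorithm n} {I : Instance n} {a b : ℝ≥0∞} (ha : a ≠ ⊤)
    {f : State n → ℝ≥0∞}
    (hf : ∀ s : State n, s.Legal → (∀ i, i ∈ s.requests) → a ≤ paid I s + f s)
    {L : ℕ} (hb : ∀ t ≥ L, expect (law A I t) f ≤ b) : a ≤ cost A I + b := by
  have hp : ∑ i, I.p i = 1 := by rw [← tsum_fintype (L := .unconditional _)]; exact I.p.tsum_coe
  have key : ∀ t ≥ L, a ≤ cost A I + b + a * ∑ i, (1 - I.p i) ^ t := by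
    intro t ht
    have h1 : a ≤ expect (law A I t) fun s => (paid I s + f s) +
        a * ∑ i, (if i ∈ s.requests then 0 else 1) := by
      rw [expect_law]
      conv_lhs => rw [← avg_const hp a t []]
      refine avg_mono (fun v => ?_) _ _
      refine (expect_const (run A I.c v) a).ge.trans (expect_mono fun s hs => ?_)
      by_cases hall : ∀ i, i ∈ s.requests
      · exact (hf s (mem_support_run hs).1 hall).trans le_self_add
      · push Not at hall
        obtain ⟨i, hi⟩ := hall
        refine le_trans ?_ le_add_self
        have h2 : (if i ∈ s.requests then 0 else 1 : ℝ≥0∞) ≤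
            ∑ i, (if i ∈ s.requests then 0 else 1) :=
          Finset.single_le_sum (f := fun i => (if i ∈ s.requests then 0 else 1 : ℝ≥0∞))
            (fun _ _ => zero_le) (Finset.mem_univ i)
        rw [if_neg hi] at h2
        simpa using mul_le_mul_right h2 a
    rw [expect_add, expect_add, expect_const_mul, expect_finset_sum] at h1
    refine h1.trans ?_
    gcongr with i
    · exact le_iSup (fun t => ∑' s, law A I t s * paid I s) t
    · exact hb t ht
    · rw [expect_law]
      refine le_trans (avg_mono (fun v => ?_) t []) (avg_notMem_le hp i t [])
      rw [← expect_const (run A I.c v) (if i ∈ v then 0 else 1)]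
      refine expect_mono fun s hs => ?_
      simp [(mem_support_run hs).2]
  have hlim : Filter.Tendsto (fun t : ℕ => cost A I + b + a * ∑ i, (1 - I.p i) ^ t)
      Filter.atTop (nhds (cost A I + b + a * ∑ _i : Fin n, 0)) := by
    refine tendsto_const_nhds.add (ENNReal.Tendsto.const_mul ?_ (Or.inr ha))
    refine tendsto_finsetSum _ fun i _ => ENNReal.tendsto_pow_atTop_nhds_zero_of_lt_one ?_
    exact ENNReal.sub_lt_self ENNReal.one_ne_top one_ne_zero (I.pos i)
  simpa using ge_of_tendsto hlim (Filter.eventually_atTop.2 ⟨L, key⟩)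

/-! ### Guessing the heavy items -/

/-- The slots given so far do not refute the guess that the items in slots of cost `0` are those
of `B`. -/
def Consistent (c : Fin n → ℝ≥0) (B : Finset (Fin n)) (s : State n) : Prop :=
  ∀ i j, s.slot i = some j → (c j = 0 ↔ i ∈ B)

open Classical in
/-- The indicator function of the positions consistent with `B`. -/
noncomputable def guess (c : Fin n → ℝ≥0) (B : Finset (Fin n)) (s : State n) : ℝ≥0∞ :=
  if Consistent c B s then 1 else 0

lemma expect_serve_guess_le {A : OnlineAlgorithm n} {c : Fin n → ℝ≥0} {B : Finset (Fin n)}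
    {i : Fin n} {s : State n} (hs : s.Legal) :
    expect (serve A c i s) (guess c B) ≤ guess c B s := by
  conv_rhs => rw [← expect_const (serve A c i s) (guess c B s)]
  refine expect_mono fun s' hs' => ?_
  obtain ⟨-, -, h⟩ := mem_support_serve hs hs'
  unfold guess
  split_ifs with h₁ h₂ h₂
  · exact le_rfl
  · exact absurd (fun i j hij => h₁ i j (h i j hij)) h₂
  · exact zero_le
  · exact le_rfl

/-- Further requests can only refute a guess, since slots are never changed. -/
lemma expect_run_cons_guess_le {A : OnlineAlgorithm n} {c : Fin n → ℝ≥0} {B : Finset (Fin n)}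
    (x : Fin n) (v : List (Fin n)) :
    expect (run A c (x :: v)) (guess c B) ≤ expect (run A c v) (guess c B) := by
  rw [run, expect_bind]
  exact expect_mono fun s hs => expect_serve_guess_le (mem_support_run hs).1

/-- The request probabilities of the hard instance: `β` on the heavy items, those of `B`, and `γ` on
the others. -/
noncomputable def weight (β γ : ℝ≥0) (B : Finset (Fin n)) (i : Fin n) : ℝ≥0∞ :=
  if i ∈ B then β else γ

/-- The probability of a word of requests. -/
noncomputable def wordWeight (β γ : ℝ≥0) (B : Finset (Fin n)) (v : List (Fin n)) : ℝ≥0∞ :=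
  (v.map (weight β γ B)).prod

lemma wordWeight_cons (β γ : ℝ≥0) (B : Finset (Fin n)) (x : Fin n) (v : List (Fin n)) :
    wordWeight β γ B (x :: v) = weight β γ B x * wordWeight β γ B v := by
  simp [wordWeight]

lemma sum_weight (β γ : ℝ≥0) (B : Finset (Fin n)) :
    ∑ i, weight β γ B i = B.card * β + ((n - B.card : ℕ) : ℝ≥0∞) * γ := by
  unfold weight
  rw [Finset.sum_ite, Finset.sum_const, Finset.sum_const, nsmul_eq_mul, nsmul_eq_mul,
    Finset.filter_mem_eq_inter, Finset.univ_inter, Finset.filter_not, Finset.filter_mem_eq_inter,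
    Finset.univ_inter, ← Finset.compl_eq_univ_sdiff, Finset.card_compl, Fintype.card_fin]

lemma wordWeight_of_subset {β γ : ℝ≥0} {B : Finset (Fin n)} {v : List (Fin n)}
    (h : v.toFinset ⊆ B) : wordWeight β γ B v = β ^ v.length := by
  induction v with
  | nil => simp [wordWeight]
  | cons x v ih =>
    rw [List.toFinset_cons, Finset.insert_subset_iff] at h
    rw [wordWeight_cons, ih h.2, weight, if_pos h.1, List.length_cons, pow_succ']

lemma wordWeight_le_one {β γ : ℝ≥0} (hβ : β ≤ 1) (hγ : γ ≤ 1) (B : Finset (Fin n))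
    (v : List (Fin n)) : wordWeight β γ B v ≤ 1 := by
  induction v with
  | nil => simp [wordWeight]
  | cons x v ih =>
    rw [wordWeight_cons]
    refine mul_le_one' ?_ ih
    unfold weight
    split_ifs <;> exact_mod_cast ‹_›

lemma wordWeight_le_of_not_subset {β γ : ℝ≥0} (hβ : β ≤ 1) (hγ : γ ≤ 1) {B : Finset (Fin n)}
    {v : List (Fin n)} (h : ¬ v.toFinset ⊆ B) : wordWeight β γ B v ≤ γ := by
  induction v with
  | nil => simp at h
  | cons x v ih =>
    rw [wordWeight_cons]
    by_cases hx : x ∈ B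
    · rw [List.toFinset_cons, Finset.insert_subset_iff] at h
      refine (mul_le_mul' ?_ (ih fun h' => h ⟨hx, h'⟩)).trans (one_mul _).le
      rw [weight, if_pos hx]; exact_mod_cast hβ
    · rw [weight, if_neg hx]
      exact (mul_le_mul' le_rfl (wordWeight_le_one hβ hγ B v)).trans (mul_one _).le

/-- When `k` of the `K` heavy items, each of probability `β`, have been requested, the probability
that none of the next `m` requests is a light item requested before all heavy ones have been seen.
In the recursion, the next request is one of the `k` old heavy items or one of the `K - k` new
ones. -/
noncomputable def survival (K : ℕ) (β : ℝ≥0) : ℕ → ℕ → ℝ≥0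
  | 0, _ => 1
  | m + 1, k => if K ≤ k then 1 else
      β * (k * survival K β m k + (K - k : ℕ) * survival K β m (k + 1))

open Finset in
/-- For a short word with few letters, the sets containing all letters are jointly at least as likely
as the other sets: each of the latter needs a light letter, and `γ` is tiny. -/
lemma sum_wordWeight_not_superset_le {K L : ℕ} (hK : K ≤ n) {β γ : ℝ≥0} (hβ : β ≤ 1) (hγ : γ ≤ 1)
    (hL : n.choose K * γ ≤ β ^ L) {v : List (Fin n)} (hv : v.toFinset.card ≤ K)
    (hvL : v.length ≤ L) :
    ∑ B ∈ powersetCard K univ with ¬ v.toFinset ⊆ B, wordWeight β γ B v ≤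
      ∑ B ∈ powersetCard K univ with v.toFinset ⊆ B, wordWeight β γ B v := by
  obtain ⟨B₀, hB₀, -, hc⟩ := exists_subsuperset_card_eq (subset_univ v.toFinset) hv
    (by simpa using hK)
  calc _ ≤ ∑ B ∈ powersetCard K (univ : Finset (Fin n)) with ¬ v.toFinset ⊆ B, (γ : ℝ≥0∞) :=
        sum_le_sum fun B hB => wordWeight_le_of_not_subset hβ hγ (mem_filter.1 hB).2
    _ ≤ ∑ B ∈ powersetCard K (univ : Finset (Fin n)), (γ : ℝ≥0∞) :=
        sum_le_sum_of_subset (filter_subset _ _)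
    _ = ((n.choose K * γ : ℝ≥0) : ℝ≥0∞) := by simp
    _ ≤ ((β ^ v.length : ℝ≥0) : ℝ≥0∞) :=
        ENNReal.coe_le_coe.2 (hL.trans (pow_le_pow_of_le_one zero_le hβ hvL))
    _ = wordWeight β γ B₀ v := by rw [wordWeight_of_subset hB₀]; simp
    _ ≤ _ := single_le_sum (f := fun B => wordWeight β γ B v) (fun _ _ => zero_le)
        (mem_filter.2 ⟨mem_powersetCard.2 ⟨subset_univ _, hc⟩, hB₀⟩)

open Finset in
/-- On a short word `v` with at most `K` letters, no assignment is better than giving free slots to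
all letters. -/
lemma sum_wordWeight_mul_guess_le {K L : ℕ} (hK : K ≤ n) {β γ : ℝ≥0} (hβ : β ≤ 1) (hγ : γ ≤ 1)
    (hL : n.choose K * γ ≤ β ^ L) {v : List (Fin n)} (hv : v.toFinset.card ≤ K)
    (hvL : v.length ≤ L) (A : OnlineAlgorithm n) (c : Fin n → ℝ≥0) :
    ∑ B ∈ powersetCard K univ, wordWeight β γ B v * expect (run A c v) (guess c B) ≤
      ∑ B ∈ powersetCard K univ with v.toFinset ⊆ B, wordWeight β γ B v := by
  simp only [← expect_const_mul, ← expect_finset_sum]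
  conv_rhs => rw [← expect_const (run A c v) (∑ B ∈ powersetCard K univ with v.toFinset ⊆ B, _)]
  refine expect_mono fun s hs => ?_
  obtain ⟨hleg, hreq⟩ := mem_support_run hs
  have hsome : ∀ i ∈ v, ∃ j, s.slot i = some j := fun i hi =>
    Option.ne_none_iff_exists'.1 ((hleg.assigned_iff i).2 (by simpa [hreq] using hi))
  classical
  have hterm : ∀ B, wordWeight β γ B v * guess c B s =
      if Consistent c B s then wordWeight β γ B v else 0 := fun B => by
    unfold guess; split_ifs <;> simp
  simp only [hterm]
  rw [← sum_filter]
  by_cases hz : ∀ i j, s.slot i = some j → c j = 0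
  -- All letters in free slots: consistent with `B` only if `B` contains all of them.
  · refine sum_le_sum_of_subset fun B hB => ?_
    rw [mem_filter] at hB ⊢
    refine ⟨hB.1, fun i hi => ?_⟩
    obtain ⟨j, hj⟩ := hsome i (by simpa using hi)
    exact (hB.2 i j hj).1 (hz i j hj)
  -- Some letter in a slot of cost `1`: consistent with `B` only if `B` misses that letter.
  · refine le_trans (sum_le_sum_of_subset fun B hB => ?_)
      (sum_wordWeight_not_superset_le hK hβ hγ hL hv hvL)
    rw [mem_filter] at hB ⊢
    refine ⟨hB.1, fun hsub => hz fun i j hij => (hB.2 i j hij).2 (hsub ?_)⟩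
    have := (hleg.assigned_iff i).1 (by simp [hij])
    simpa [hreq] using this

open Finset in
/-- The central estimate, by induction on the number `m` of remaining requests. Once `K` letters have
been seen, the algorithm's later choices are ignored, because consistency can only get lost. -/
lemma sum_wordWeight_mul_avg_guess_le {K L : ℕ} (hK : K ≤ n) {β γ : ℝ≥0}
    (hβγ : K * β + (n - K : ℕ) * γ = 1) (hβ : β ≤ 1) (hγ : γ ≤ 1)
    (hL : n.choose K * γ ≤ β ^ L) (A : OnlineAlgorithm n) (c : Fin n → ℝ≥0) (m : ℕ)
    (v : List (Fin n)) (hv : v.toFinset.card ≤ K) (hvL : v.length + m ≤ L) :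
    ∑ B ∈ powersetCard K univ, wordWeight β γ B v *
        avg (weight β γ B) (fun u => expect (run A c u) (guess c B)) m v ≤
      (∑ B ∈ powersetCard K univ with v.toFinset ⊆ B, wordWeight β γ B v) *
        survival K β m v.toFinset.card := by
  have hsum : ∀ B ∈ powersetCard K (univ : Finset (Fin n)), ∑ i, weight β γ B i = 1 := by
    intro B hB
    rw [sum_weight, (mem_powersetCard.1 hB).2]
    exact_mod_cast hβγ
  induction m generalizing v with
  | zero =>
    simpa [survival, avg] using sum_wordWeight_mul_guess_le hK hβ hγ hL hv hvL A c
  | succ m ih =>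
    by_cases hk : K ≤ v.toFinset.card
    · rw [survival, if_pos hk, ENNReal.coe_one, mul_one]
      refine le_trans (sum_le_sum fun B hB => ?_)
        (sum_wordWeight_mul_guess_le hK hβ hγ hL hv (by omega) A c)
      exact mul_le_mul_right (avg_antitone (hsum B hB) expect_run_cons_guess_le v
        (Nat.zero_le (m + 1))) _
    · push Not at hk
      have hcard : ∀ x, (insert x v.toFinset).card ≤ K := fun x =>
        (card_insert_le _ _).trans hk
      calc ∑ B ∈ powersetCard K univ, wordWeight β γ B v *
            avg (weight β γ B) (fun u => expect (run A c u) (guess c B)) (m + 1) v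
          = ∑ x, ∑ B ∈ powersetCard K univ, wordWeight β γ B (x :: v) *
            avg (weight β γ B) (fun u => expect (run A c u) (guess c B)) m (x :: v) := by
            rw [sum_comm]
            refine sum_congr rfl fun B _ => ?_
            rw [avg, mul_sum]
            refine sum_congr rfl fun x _ => ?_
            rw [wordWeight_cons]; ring
        _ ≤ ∑ x, (∑ B ∈ powersetCard K univ with (x :: v).toFinset ⊆ B,
              wordWeight β γ B (x :: v)) * survival K β m (x :: v).toFinset.card :=
            sum_le_sum fun x _ => ih (x :: v) (by simpa using hcard x)
              (by simp only [List.length_cons]; omega)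
        _ = ∑ B ∈ powersetCard K univ with v.toFinset ⊆ B, ∑ x ∈ B,
              β * wordWeight β γ B v * survival K β m (insert x v.toFinset).card := by
            simp only [sum_filter, sum_mul]
            rw [sum_comm]
            refine sum_congr rfl fun B _ => ?_
            by_cases hB : v.toFinset ⊆ B
            · rw [if_pos hB]
              refine (sum_subset (subset_univ B) fun x _ hx => ?_).symm.trans
                (sum_congr rfl fun x hx => ?_)
              · rw [List.toFinset_cons, if_neg, zero_mul]
                exact fun h => hx (h (mem_insert_self _ _))
              · rw [List.toFinset_cons, if_pos (insert_subset hx hB), wordWeight_cons, weight,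
                  if_pos hx]
            · rw [if_neg hB]
              refine sum_eq_zero fun x _ => ?_
              rw [List.toFinset_cons, if_neg, zero_mul]
              exact fun h => hB ((subset_insert _ _).trans h)
        _ = _ := by
            rw [sum_mul]
            refine sum_congr rfl fun B hB => ?_
            obtain ⟨hB, hvB⟩ := mem_filter.1 hB
            rw [survival, if_neg (not_le.2 hk), ← mul_sum, ← sum_sdiff hvB]
            have h1 : ∀ x ∈ B \ v.toFinset,
                (survival K β m (insert x v.toFinset).card : ℝ≥0∞) =
                  survival K β m (v.toFinset.card + 1) := fun x hx => by
              rw [card_insert_of_notMem (mem_sdiff.1 hx).2]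
            have h2 : ∀ x ∈ v.toFinset,
                (survival K β m (insert x v.toFinset).card : ℝ≥0∞) =
                  survival K β m v.toFinset.card := fun x hx => by
              rw [insert_eq_of_mem hx]
            rw [sum_congr rfl h1, sum_congr rfl h2, sum_const, sum_const,
              card_sdiff_of_subset hvB, (mem_powersetCard.1 hB).2]
            push_cast
            simp only [nsmul_eq_mul]
            push_cast
            ring

lemma sum_avg_guess_le {K L : ℕ} (hK : K ≤ n) {β γ : ℝ≥0}
    (hβγ : K * β + (n - K : ℕ) * γ = 1) (hβ : β ≤ 1) (hγ : γ ≤ 1)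
    (hL : n.choose K * γ ≤ β ^ L) (A : OnlineAlgorithm n) (c : Fin n → ℝ≥0) :
    ∑ B ∈ Finset.powersetCard K Finset.univ,
        avg (weight β γ B) (fun u => expect (run A c u) (guess c B)) L [] ≤
      n.choose K * survival K β L 0 := by
  simpa [wordWeight] using
    sum_wordWeight_mul_avg_guess_le hK hβγ hβ hγ hL A c L [] (by simp) (by simp)

/-! ### The hard instances -/

/-- The cost vector with `K` slots of cost `0` followed by slots of cost `1`. -/
def threshold (n K : ℕ) (j : Fin n) : ℝ≥0 := if (j : ℕ) < K then 0 else 1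

lemma threshold_eq_zero {K : ℕ} {j : Fin n} : threshold n K j = 0 ↔ (j : ℕ) < K := by
  unfold threshold; split_ifs with h <;> simp [h]

lemma threshold_monotone (n K : ℕ) : Monotone (threshold n K) := by
  intro i j hij
  unfold threshold
  have : (i : ℕ) ≤ j := hij
  split_ifs <;> first | omega | simp

lemma isZeroOne_threshold (n K : ℕ) : IsZeroOne (threshold n K) := by
  intro j
  unfold threshold
  split_ifs <;> simp

lemma card_filter_lt {K : ℕ} (hK : K ≤ n) :
    (Finset.univ.filter fun j : Fin n => (j : ℕ) < K).card = K := by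
  rw [Fin.card_filter_val_lt, min_eq_right hK]

lemma numNonMaximal_threshold {K : ℕ} (hK : K < n) : numNonMaximal (threshold n K) = K := by
  have : {i | ∃ j, threshold n K i < threshold n K j} =
      ((Finset.univ.filter fun j : Fin n => (j : ℕ) < K : Finset (Fin n)) : Set (Fin n)) := by
    ext i
    simp only [Set.mem_ofPred_eq, Finset.coe_filter, Finset.mem_univ, true_and]
    constructor
    · rintro ⟨j, hj⟩
      by_contra h
      unfold threshold at hj
      split_ifs at hj <;> simp at hj
    · exact fun h => ⟨⟨K, hK⟩, by simp [threshold, h]⟩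
  rw [numNonMaximal, this, Set.ncard_coe_finset, card_filter_lt hK.le]

lemma isConcave_threshold_one (n : ℕ) : IsConcave (threshold n 1) := by
  intro i h
  have : threshold n 1 ⟨i, by omega⟩ ≤ threshold n 1 ⟨i + 1, by omega⟩ :=
    threshold_monotone n 1 (by simp [Fin.le_def])
  have h2 : (threshold n 1 ⟨i, by omega⟩ : ℝ) ≤ threshold n 1 ⟨i + 1, by omega⟩ := this
  have h3 : threshold n 1 ⟨i + 2, h⟩ = threshold n 1 ⟨i + 1, by omega⟩ := by simp [threshold]
  rw [h3]; linarith

/-- The instance with `K` slots of cost `0` and heavy items `B`. -/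
noncomputable def hardInstance {K : ℕ} {β γ : ℝ≥0} (hβ : β ≠ 0) (hγ : γ ≠ 0)
    (hβγ : K * β + (n - K : ℕ) * γ = 1) (B : Finset (Fin n)) (hB : B.card = K) : Instance n where
  c := threshold n K
  mono := threshold_monotone n K
  p := PMF.ofFintype (weight β γ B) (by rw [sum_weight, hB]; exact_mod_cast hβγ)
  pos i := by
    rw [PMF.ofFintype_apply, weight]
    split_ifs <;> simpa

lemma sum_weight_compl (β γ : ℝ≥0) {K : ℕ} {B : Finset (Fin n)} (hB : B.card = K) :
    ∑ i, weight β γ B i * (if i ∈ B then 0 else 1) = ((n - K : ℕ) * γ : ℝ≥0) := by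
  have : ∀ i, weight β γ B i * (if i ∈ B then 0 else 1) = if i ∉ B then (γ : ℝ≥0∞) else 0 := by
    intro i; unfold weight; split_ifs <;> simp_all
  simp only [this]
  rw [← Finset.sum_filter, Finset.sum_const, nsmul_eq_mul, Finset.filter_not,
    Finset.filter_mem_eq_inter, Finset.univ_inter, ← Finset.compl_eq_univ_sdiff,
    Finset.card_compl, Fintype.card_fin, hB, ENNReal.coe_mul, ENNReal.coe_natCast]

section Hard
variable {K : ℕ} {β γ : ℝ≥0} (hβ : β ≠ 0) (hγ : γ ≠ 0)
    (hβγ : K * β + (n - K : ℕ) * γ = 1) (B : Finset (Fin n)) (hB : B.card = K)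

lemma opt_hardInstance_le (hK : K ≤ n) :
    opt (hardInstance hβ hγ hβγ B hB) ≤ ((n - K : ℕ) * γ : ℝ≥0) := by
  have hcard : Fintype.card {i // i ∈ B} = Fintype.card {j : Fin n // (j : ℕ) < K} := by
    rw [Fintype.card_coe, hB, Fintype.card_subtype, card_filter_lt hK]
  let e := Fintype.equivOfCardEq hcard
  refine (iInf_le _ e.extendSubtype).trans (le_of_eq ?_)
  rw [← sum_weight_compl β γ hB]
  refine Finset.sum_congr rfl fun i _ => ?_
  have : threshold n K (e.extendSubtype i) = if i ∈ B then 0 else 1 := by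
    unfold threshold
    split_ifs with h₁ h₂ h₂
    · rfl
    · exact absurd h₁ (e.extendSubtype_not_mem i h₂)
    · exact absurd (e.extendSubtype_mem i h₂) h₁
    · rfl
  change weight β γ B i * (threshold n K _ : ℝ≥0∞) = _
  rw [this]
  split_ifs <;> simp

/-- On a complete position the cost is at least `β`, unless exactly the items of `B` have free slots,
when it is `(n - K) γ`. -/
lemma le_paid_add_guess (hK : K ≤ n) (hδ : (n - K : ℕ) * γ ≤ β) {s : State n} (hs : s.Legal)
    (hall : ∀ i, i ∈ s.requests) :
    (β : ℝ≥0∞) ≤ paid (hardInstance hβ hγ hβγ B hB) s +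
      ((β - (n - K : ℕ) * γ : ℝ≥0) : ℝ≥0∞) * guess (threshold n K) B s := by
  choose σ hσ using fun i => Option.ne_none_iff_exists'.1 ((hs.assigned_iff i).2 (hall i))
  have hinj : Function.Injective σ := fun i i' h =>
    hs.injective i i' (σ i) (hσ i) (by rw [hσ i', h])
  have hpaid : paid (hardInstance hβ hγ hβγ B hB) s =
      ∑ i, weight β γ B i * (threshold n K (σ i) : ℝ≥0∞) := by
    refine Finset.sum_congr rfl fun i _ => ?_
    rw [hσ i]; rfl
  rw [hpaid]
  by_cases h : ∀ i ∈ B, (σ i : ℕ) < K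
  · have himg : B.image σ = Finset.univ.filter fun j : Fin n => (j : ℕ) < K := by
      refine Finset.eq_of_subset_of_card_le (fun j hj => ?_) ?_
      · obtain ⟨i, hi, rfl⟩ := Finset.mem_image.1 hj
        simpa using h i hi
      · rw [card_filter_lt hK, Finset.card_image_of_injective _ hinj, hB]
    have hiff : ∀ i, (σ i : ℕ) < K ↔ i ∈ B := by
      refine fun i => ⟨fun hi => ?_, h i⟩
      have : σ i ∈ B.image σ := by rw [himg]; simpa using hi
      obtain ⟨i', hi', he⟩ := Finset.mem_image.1 this
      exact hinj he ▸ hi'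
    have hcons : Consistent (threshold n K) B s := by
      intro i j hij
      rw [threshold_eq_zero, ← hiff i]
      rw [hσ i, Option.some_inj] at hij
      rw [hij]
    have hsum : ∑ i, weight β γ B i * (threshold n K (σ i) : ℝ≥0∞) =
        ((n - K : ℕ) * γ : ℝ≥0) := by
      rw [← sum_weight_compl β γ hB]
      refine Finset.sum_congr rfl fun i _ => ?_
      simp only [threshold, hiff i]
      split_ifs <;> simp
    rw [hsum, guess, if_pos hcons, mul_one, ← ENNReal.coe_add, add_tsub_cancel_of_le hδ]
  · push Not at h
    obtain ⟨i, hi, hKi⟩ := h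
    refine le_trans ?_ le_self_add
    refine le_trans (le_of_eq ?_) (Finset.single_le_sum
      (f := fun i => weight β γ B i * (threshold n K (σ i) : ℝ≥0∞))
      (fun _ _ => zero_le) (Finset.mem_univ i))
    simp [weight, hi, threshold, not_lt.2 hKi]

end Hard

/-! ### The lower bound for fixed parameters -/

lemma le_optimalRatio_mul_add {K L : ℕ} (hK : K < n) {β γ : ℝ≥0} (hβ : β ≠ 0) (hγ : γ ≠ 0)
    (hβγ : K * β + (n - K : ℕ) * γ = 1) (hβ1 : β ≤ 1) (hδ : (n - K : ℕ) * γ ≤ β)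
    (hL : n.choose K * γ ≤ β ^ L) :
    (β : ℝ≥0∞) ≤ optimalRatio {I : Instance n | I.c = threshold n K} * ((n - K : ℕ) * γ : ℝ≥0) +
      ((β - (n - K : ℕ) * γ : ℝ≥0) : ℝ≥0∞) * survival K β L 0 := by
  set δ : ℝ≥0 := (n - K : ℕ) * γ with hδdef
  have hnK : ((n - K : ℕ) : ℝ≥0) ≠ 0 := by
    rw [Nat.cast_ne_zero]; omega
  have hδ0 : δ ≠ 0 := mul_ne_zero hnK hγ
  have hγ1 : γ ≤ 1 := by
    refine le_trans ?_ (hδ.trans hβ1)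
    have : (1 : ℝ≥0) ≤ (n - K : ℕ) := by exact_mod_cast (by omega : 1 ≤ n - K)
    exact le_mul_of_one_le_left zero_le this
  have hδ0' : (δ : ℝ≥0∞) ≠ 0 := by exact_mod_cast hδ0
  suffices h : ∀ A : OnlineAlgorithm n, ((β : ℝ≥0∞) -
      ((β - δ : ℝ≥0) : ℝ≥0∞) * survival K β L 0) / δ ≤
        competitiveRatio A {I : Instance n | I.c = threshold n K} by
    have h2 := le_iInf h
    rw [ENNReal.div_le_iff hδ0' ENNReal.coe_ne_top] at h2
    exact tsub_le_iff_right.1 h2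
  intro A
  rw [ENNReal.div_le_iff hδ0' ENNReal.coe_ne_top, tsub_le_iff_right]
  set ρ := competitiveRatio A {I : Instance n | I.c = threshold n K}
  have hone : ∀ B ∈ Finset.powersetCard K (Finset.univ : Finset (Fin n)),
      (β : ℝ≥0∞) ≤ ρ * δ + ((β - δ : ℝ≥0) : ℝ≥0∞) *
        avg (weight β γ B) (fun u => expect (run A (threshold n K) u)
          (guess (threshold n K) B)) L [] := by
    intro B hB
    have hB := (Finset.mem_powersetCard.1 hB).2
    set I := hardInstance hβ hγ hβγ B hB with hI
    have hcost : cost A I ≤ ρ * δ := by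
      have h1 : cost A I / opt I ≤ ρ :=
        le_iSup₂ (f := fun (I : Instance n) (_ : I ∈ {I : Instance n | I.c = threshold n K}) =>
          cost A I / opt I) I rfl
      rw [← ENNReal.div_le_iff hδ0' ENNReal.coe_ne_top]
      exact (ENNReal.div_le_div_left (opt_hardInstance_le hβ hγ hβγ B hB hK.le) _).trans h1
    refine (le_cost_add (A := A) (I := I) ENNReal.coe_ne_top
      (f := fun s => ((β - δ : ℝ≥0) : ℝ≥0∞) * guess (threshold n K) B s)
      (fun s hs hall => le_paid_add_guess hβ hγ hβγ B hB hK.le hδ hs hall)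
      (L := L) fun t ht => ?_).trans (add_le_add_left hcost _)
    rw [expect_const_mul, expect_law]
    refine mul_le_mul_right ?_ _
    have hsum : ∑ i, weight β γ B i = 1 := by
      rw [sum_weight, hB]
      exact_mod_cast hβγ
    exact avg_antitone hsum expect_run_cons_guess_le [] ht
  have hN0 : (n.choose K : ℝ≥0∞) ≠ 0 := by
    exact_mod_cast (Nat.choose_pos hK.le).ne'
  have hall := Finset.sum_le_sum hone
  rw [Finset.sum_add_distrib, Finset.sum_const, Finset.sum_const, ← Finset.mul_sum,
    Finset.card_powersetCard, Finset.card_univ, Fintype.card_fin, nsmul_eq_mul,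
    nsmul_eq_mul] at hall
  replace hall := hall.trans (add_le_add_right (mul_le_mul_right
    (sum_avg_guess_le hK.le hβγ hβ1 hγ1 hL A (threshold n K)) _) _)
  exact (ENNReal.mul_le_mul_iff_right hN0 (ENNReal.natCast_ne_top _)).1
    (hall.trans_eq (by ring))

/-! ### The coupon collector's time -/

/-- The normalized probability `(1 - survival) / (1 - K β)` of requesting a light item too early. For
`β = 1 / K` it is the expected time, truncated at `m`, until a coupon collector owning `k` of `K`
coupons has all of them. -/
noncomputable def missTime (K : ℕ) (β : ℝ) : ℕ → ℕ → ℝ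
  | 0, _ => 0
  | m + 1, k => if K ≤ k then 0 else
      1 + β * (k * missTime K β m k + (K - k) * missTime K β m (k + 1))

lemma survival_eq (K : ℕ) (β : ℝ≥0) (m k : ℕ) :
    (survival K β m k : ℝ) = 1 - (1 - K * β) * missTime K β m k := by
  induction m generalizing k with
  | zero => simp [survival, missTime]
  | succ m ih =>
    rw [survival, missTime]
    split_ifs with h
    · simp
    · simp only [NNReal.coe_mul, NNReal.coe_add, NNReal.coe_natCast,
        Nat.cast_sub (not_le.1 h).le, ih]
      ring

lemma continuous_missTime (K m k : ℕ) : Continuous fun β => missTime K β m k := by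
  induction m generalizing k with
  | zero => exact continuous_const
  | succ m ih =>
    simp only [missTime]
    split_ifs
    · exact continuous_const
    · have h1 := ih k
      have h2 := ih (k + 1)
      fun_prop

open Filter Topology in
/-- The truncated times increase and are bounded by `K H_{K-k}`. Their limits satisfy the recursion
without truncation, which determines them downwards from `k = K`. -/
lemma tendsto_missTime {K : ℕ} (hK : K ≠ 0) {k : ℕ} (hk : k ≤ K) :
    Tendsto (fun m => missTime K (K : ℝ)⁻¹ m k) atTop (𝓝 (K * (harmonic (K - k) : ℝ))) := by
  have hK0 : (0 : ℝ) < K := by exact_mod_cast Nat.pos_of_ne_zero hK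
  have hmono : ∀ m k, missTime K (K : ℝ)⁻¹ m k ≤ missTime K (K : ℝ)⁻¹ (m + 1) k := by
    intro m
    induction m with
    | zero =>
      intro k
      simp only [missTime]
      split_ifs <;> simp
    | succ m ih =>
      intro k
      rw [missTime, missTime]
      split_ifs with h
      · exact le_rfl
      · have : (k : ℝ) ≤ K := by exact_mod_cast (not_le.1 h).le
        gcongr
        · exact ih k
        · exact ih (k + 1)
  have hharm : ∀ k < K, (harmonic (K - k) : ℝ) = harmonic (K - (k + 1)) + ((K : ℝ) - k)⁻¹ := by
    intro k hk
    obtain ⟨d, hd⟩ : ∃ d, K - k = d + 1 := ⟨K - k - 1, by omega⟩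
    rw [hd, harmonic_succ, show K - (k + 1) = d by omega]
    have : (K : ℝ) - k = d + 1 := by rw [← Nat.cast_sub hk.le, hd]; push_cast; rfl
    rw [this]; push_cast; rfl
  have hbound : ∀ m k, k ≤ K → missTime K (K : ℝ)⁻¹ m k ≤ K * (harmonic (K - k) : ℝ) := by
    intro m
    induction m with
    | zero =>
      intro k _
      simp only [missTime]
      have : (0 : ℚ) ≤ harmonic (K - k) := Finset.sum_nonneg fun _ _ => by positivity
      exact mul_nonneg hK0.le (by exact_mod_cast this)
    | succ m ih =>
      intro k hk
      rw [missTime]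
      split_ifs with h
      · simp [show K - k = 0 by omega]
      · have hlt : (k : ℝ) < K := by exact_mod_cast not_le.1 h
        have h1 := ih k hk
        have h2 := ih (k + 1) (by omega)
        have h3 := hharm k (by omega)
        have hpos : 0 < (K : ℝ) - k := by linarith
        calc 1 + (K : ℝ)⁻¹ * (k * missTime K (K : ℝ)⁻¹ m k +
              (K - k) * missTime K (K : ℝ)⁻¹ m (k + 1))
            ≤ 1 + (K : ℝ)⁻¹ * (k * (K * (harmonic (K - k) : ℝ)) +
              (K - k) * (K * (harmonic (K - (k + 1)) : ℝ))) := by gcongr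
          _ = K * (harmonic (K - k) : ℝ) := by
            rw [h3]; field_simp; ring
  have hconv : ∀ k ≤ K, ∃ l, Tendsto (fun m => missTime K (K : ℝ)⁻¹ m k) atTop (𝓝 l) :=
    fun k hk => ⟨_, tendsto_atTop_ciSup (monotone_nat_of_le_succ fun m => hmono m k)
      ⟨_, Set.forall_mem_range.2 fun m => hbound m k hk⟩⟩
  induction hk using Nat.decreasingInduction with
  | self =>
    simp only [tsub_self, harmonic_zero, Rat.cast_zero, mul_zero]
    refine tendsto_const_nhds.congr fun m => ?_
    cases m <;> simp [missTime]
  | of_succ k hk ih =>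
    obtain ⟨l, hl⟩ := hconv k hk.le
    have h1 := (((hl.const_mul (k : ℝ)).add (ih.const_mul ((K : ℝ) - k))).const_mul
      (K : ℝ)⁻¹).const_add 1
    have h2 := hl.comp (tendsto_add_atTop_nat 1)
    have h3 := tendsto_nhds_unique h2 (h1.congr fun m => by
      simp [missTime, not_le.2 hk])
    have hpos : 0 < (K : ℝ) - k := by
      have : (k : ℝ) < K := by exact_mod_cast hk
      linarith
    convert hl using 2
    rw [hharm k hk]
    field_simp at h3 ⊢
    linarith

/-! ### The limit -/

lemma one_add_mul_missTime_le {K L : ℕ} (hK : K < n) {β γ : ℝ≥0} (hβ : β ≠ 0) (hγ : γ ≠ 0)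
    (hβγ : K * β + (n - K : ℕ) * γ = 1) (hβ1 : β ≤ 1) (hδ : (n - K : ℕ) * γ ≤ β)
    (hL : n.choose K * γ ≤ β ^ L)
    (hρ : optimalRatio {I : Instance n | I.c = threshold n K} ≠ ⊤) :
    1 + ((β : ℝ) - (n - K : ℕ) * γ) * missTime K β L 0 ≤
      (optimalRatio {I : Instance n | I.c = threshold n K}).toReal := by
  have h := le_optimalRatio_mul_add hK hβ hγ hβγ hβ1 hδ hL
  lift optimalRatio {I : Instance n | I.c = threshold n K} to ℝ≥0 using hρ with ρ
  have hδ0 : 0 < ((n - K : ℕ) : ℝ) * γ := by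
    have : 0 < n - K := by omega
    have : 0 < γ := pos_iff_ne_zero.2 hγ
    positivity
  have h2 : β ≤ ρ * ((n - K : ℕ) * γ) + (β - (n - K : ℕ) * γ) * survival K β L 0 := by
    exact_mod_cast h
  rw [← NNReal.coe_le_coe] at h2
  simp only [NNReal.coe_add, NNReal.coe_mul, NNReal.coe_sub hδ, NNReal.coe_natCast] at h2
  have h3 : (K : ℝ) * β + (n - K : ℕ) * γ = 1 := by
    simpa only [NNReal.coe_add, NNReal.coe_mul, NNReal.coe_natCast, NNReal.coe_one] using
      congrArg ((↑) : ℝ≥0 → ℝ) hβγ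
  rw [survival_eq, show (1 : ℝ) - K * β = (n - K : ℕ) * γ by linarith] at h2
  rw [ENNReal.coe_toReal]
  refine le_of_mul_le_mul_right ?_ hδ0
  linarith

open Filter Topology in
lemma le_optimalRatio_threshold {K : ℕ} (hK : K < n) :
    ENNReal.ofReal (1 + (harmonic K : ℝ)) ≤
      optimalRatio {I : Instance n | I.c = threshold n K} := by
  by_cases hρ : optimalRatio {I : Instance n | I.c = threshold n K} = ⊤
  · simp [hρ]
  refine ENNReal.ofReal_le_of_le_toReal ?_
  -- Without free slots there are no heavy items, and `β = 1` merely satisfies the side conditions.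
  obtain rfl | hK0 := eq_or_ne K 0
  · have hn : (n : ℝ≥0) ≠ 0 := by exact_mod_cast hK.ne'
    have h := one_add_mul_missTime_le (L := 0) hK (β := 1) (γ := (n : ℝ≥0)⁻¹) one_ne_zero
      (inv_ne_zero hn) (by simp [hn]) le_rfl (by simp [hn])
      (by simpa using Nat.cast_inv_le_one n) hρ
    simpa [missTime] using h
  have hK0' : (0 : ℝ) < K := by exact_mod_cast Nat.pos_of_ne_zero hK0
  have hK1 : (1 : ℝ) ≤ K := by exact_mod_cast Nat.pos_of_ne_zero hK0
  set ρ := (optimalRatio {I : Instance n | I.c = threshold n K}).toReal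
  have hfix : ∀ L, 1 + (K : ℝ)⁻¹ * missTime K (K : ℝ)⁻¹ L 0 ≤ ρ := by
    intro L
    have hβc : Continuous fun γ : ℝ => (K : ℝ)⁻¹ * (1 - (n - K : ℕ) * γ) := by fun_prop
    have hm := (continuous_missTime K L 0).comp hβc
    have hlim : Tendsto (fun γ : ℝ => 1 + ((K : ℝ)⁻¹ * (1 - (n - K : ℕ) * γ) - (n - K : ℕ) * γ) *
        missTime K ((K : ℝ)⁻¹ * (1 - (n - K : ℕ) * γ)) L 0) (𝓝[>] 0)
        (𝓝 (1 + (K : ℝ)⁻¹ * missTime K (K : ℝ)⁻¹ L 0)) := by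
      have hc : Continuous (fun γ : ℝ => 1 + ((K : ℝ)⁻¹ * (1 - (n - K : ℕ) * γ) -
          (n - K : ℕ) * γ) * missTime K ((K : ℝ)⁻¹ * (1 - (n - K : ℕ) * γ)) L 0) :=
        continuous_const.add ((hβc.sub (by fun_prop)).mul hm)
      have := (hc.tendsto 0).mono_left (nhdsWithin_le_nhds (s := Set.Ioi 0))
      simpa using this
    refine le_of_tendsto hlim ?_
    have e1 : ∀ᶠ γ : ℝ in 𝓝[>] 0, 0 < (K : ℝ)⁻¹ * (1 - (n - K : ℕ) * γ) :=
      nhdsWithin_le_nhds (continuousAt_const.eventually_lt hβc.continuousAt (by simpa using hK0'))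
    have e2 : ∀ᶠ γ : ℝ in 𝓝[>] 0, (n - K : ℕ) * γ < (K : ℝ)⁻¹ * (1 - (n - K : ℕ) * γ) :=
      nhdsWithin_le_nhds (ContinuousAt.eventually_lt (by fun_prop) hβc.continuousAt
        (by simpa using hK0'))
    have e3 : ∀ᶠ γ : ℝ in 𝓝[>] 0,
        (n.choose K : ℝ) * γ < ((K : ℝ)⁻¹ * (1 - (n - K : ℕ) * γ)) ^ L :=
      nhdsWithin_le_nhds (ContinuousAt.eventually_lt (by fun_prop) (by fun_prop)
        (by simpa using pow_pos hK0' L))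
    filter_upwards [e1, e2, e3, self_mem_nhdsWithin] with γ h1 h2 h3 (hγ : 0 < γ)
    have hsum : (K : ℝ) * ((K : ℝ)⁻¹ * (1 - (n - K : ℕ) * γ)) + (n - K : ℕ) * γ = 1 := by
      field_simp; ring
    have hδ : 0 ≤ ((n - K : ℕ) : ℝ) * γ := by positivity
    generalize (K : ℝ)⁻¹ * (1 - (n - K : ℕ) * γ) = β at *
    lift γ to ℝ≥0 using hγ.le
    lift β to ℝ≥0 using h1.le
    have hβ1 : (β : ℝ) ≤ 1 := by nlinarith
    exact one_add_mul_missTime_le hK (by rintro rfl; simp at h1) (by rintro rfl; simp at hγ)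
      (NNReal.coe_injective (by
        simpa only [NNReal.coe_add, NNReal.coe_mul, NNReal.coe_natCast, NNReal.coe_one] using
          hsum)) (by exact_mod_cast hβ1) (by exact_mod_cast h2.le)
      (by exact_mod_cast h3.le) hρ
  have hlim := ((tendsto_missTime hK0 (Nat.zero_le K)).const_mul (K : ℝ)⁻¹).const_add 1
  rw [Nat.sub_zero, inv_mul_cancel_left₀ hK0'.ne'] at hlim
  exact le_of_tendsto' hlim hfix

lemma optimalRatio_mono {X Y : Set (Instance n)} (h : X ⊆ Y) : optimalRatio X ≤ optimalRatio Y :=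
  iInf_mono fun _ => iSup_le_iSup_of_subset h

end OSA

theorem theorem3 :
    (∀ K n : ℕ, K < n →
      ENNReal.ofReal (1 + (harmonic K : ℝ)) ≤
        OSA.optimalRatio {I : OSA.Instance n | OSA.IsZeroOne I.c ∧ OSA.numNonMaximal I.c = K}) ∧
    (∀ n : ℕ, 2 ≤ n →
      2 ≤ OSA.optimalRatio {I : OSA.Instance n | OSA.IsZeroOne I.c ∧ OSA.IsConcave I.c}) := by
  refine ⟨fun K n hK => (OSA.le_optimalRatio_threshold hK).trans (OSA.optimalRatio_mono ?_),
    fun n hn => ?_⟩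
  · rintro I (hI : I.c = _)
    simp only [Set.mem_ofPred_eq, hI]
    exact ⟨OSA.isZeroOne_threshold n K, OSA.numNonMaximal_threshold hK⟩
  · have h := OSA.le_optimalRatio_threshold (show 1 < n by omega)
    have h2 : ENNReal.ofReal (1 + (harmonic 1 : ℝ)) = 2 := by norm_num [harmonic_succ]
    rw [h2] at h
    refine h.trans (OSA.optimalRatio_mono ?_)
    rintro I (hI : I.c = _)
    simp only [Set.mem_ofPred_eq, hI]
    exact ⟨OSA.isZeroOne_threshold n 1, OSA.isConcave_threshold_one n⟩
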